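/- Let $N=\{0,1,\dots,n\}$ be a finite set of players with arbitrary (possibly infinite) action sets $S_0,\dots,S_n$; write $S=\prod_{i=0}^n S_i$, $S_+=\prod_{j=1}^n S_j$, and $s=(s_0,s_+)$ for $s\in S$. Let $\{\succeq_{s_+}\}_{s_+\in S_+}$ be a family of preference orders (complete transitive relations) on $S_0$, with strict part $\succ_{s_+}$. A \emph{balanced sequence} is a finite sequence of pairs $(r^k,t^k)_{k=1}^m$ in $S\times S$ such that (a) $r^k_+=t^k_+$ for each $k$; (b) $r^k_0\succeq_{r^k_+}t^k_0$ for each $k$, with $r^k_0\succ_{r^k_+}t^k_0$ for at least one $k$; (c) for each $j\in\{1,\dots,n\}$, each pair $(a,b)\in S_0\times S_j$ appears the same number of times in $(r^1_0,r^1_j),\dots,(r^m_0,r^m_j)$ as in $(t^1_0,t^1_j),\dots,(t^m_0,t^m_j)$. The family admits a \emph{strategically separable lexicographic representation} if there are a linearly ordered set $M$ and functions $g_j:S_0\times S_j\to\mathbb{R}^M$, $j=1,\dots,n$, such that for all $s_+\in S_+$ and $s_0,s_0'\in S_0$ $$s_0\succeq_{s_+}s_0'\iff\sum_{j=1}^n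 g_j(s_0,s_j)\geq_{lex}\sum_{j=1}^n g_j(s_0',s_j),$$ where $x\geq_{lex}y$ means that $x=y$, or that there is a smallest $l\in M$ with $x_l\neq y_l$ and $x_l>y_l$ for this $l$. \textbf{Theorem.} The family $\{\succeq_{s_+}\}_{s_+\in S_+}$ admits a strategically separable lexicographic representation if and only if there are no balanced sequences. The same equivalence holds if one requires in addition that for every $j$ and $(s_0,s_j)\in S_0\times S_j$ the set $\{m\in M : g_j(s_0,s_j)(m)\neq 0\}$ is well-ordered. -/

import Mathlib

universe u

/-- The profiles `s₊ = (s₁, …, sₙ)` of actions of the opponents `1, …, n`, where the players are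
`0, 1, …, n` and `S i` is the action set of player `i`. -/
abbrev OpponentProfile {n : ℕ} (S : Fin (n + 1) → Type u) : Type u :=
  ∀ j : Fin n, S j.succ

/-- A family of preference orders `≿_{s₊}` (complete transitive relations) of player `0` over her
own actions, one for each opponent profile `s₊`; `P.weak s₊ a b` means `a ≿_{s₊} b`. -/
structure PreferenceFamily {n : ℕ} (S : Fin (n + 1) → Type u) where
  weak : OpponentProfile S → S 0 → S 0 → Prop
  complete : ∀ s a b, weak s a b ∨ weak s b a
  trans : ∀ s a b c, weak s a b → weak s b c → weak s a c

namespace PreferenceFamily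

variable {n : ℕ} {S : Fin (n + 1) → Type u}

/-- Strict preference `a ≻_{s₊} b`. -/
def strict (P : PreferenceFamily S) (s : OpponentProfile S) (a b : S 0) : Prop :=
  P.weak s a b ∧ ¬ P.weak s b a

/-- The pairs `(r k, t k)` of strategy profiles, for `k` in `Fin m`, form a balanced sequence.
`Fin.tail x` is the opponent part `x₊` of a profile `x`. -/
structure IsBalancedSequence (P : PreferenceFamily S) (m : ℕ) (r t : Fin m → ∀ i, S i) :
    Prop where
  opponents_eq : ∀ k, Fin.tail (r k) = Fin.tail (t k)
  weak : ∀ k, P.weak (Fin.tail (r k)) (r k 0) (t k 0)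
  exists_strict : ∃ k, P.strict (Fin.tail (r k)) (r k 0) (t k 0)
  balanced : ∀ (j : Fin n) (a : S 0) (b : S j.succ),
    {k | r k 0 = a ∧ r k j.succ = b}.ncard = {k | t k 0 = a ∧ t k j.succ = b}.ncard

/-- The family admits a balanced sequence (of some length). -/
def AdmitsBalancedSequence (P : PreferenceFamily S) : Prop :=
  ∃ (m : ℕ) (r t : Fin m → ∀ i, S i), P.IsBalancedSequence m r t

/-- The functions `g j : S₀ × S_j → ℝ^M` represent the family through additively separable
utilities in `ℝ^M`.  The order on `Lex (M → ℝ)` is the lexicographic one: `toLex y ≤ toLex x` iff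
`x = y`, or there is a smallest index at which `x` and `y` differ and `x` is larger there. -/
def IsLexRepresentation (P : PreferenceFamily S) {M : Type u} [LinearOrder M]
    (g : ∀ j : Fin n, S 0 → S j.succ → M → ℝ) : Prop :=
  ∀ (s : OpponentProfile S) (a b : S 0),
    P.weak s a b ↔ toLex (∑ j, g j b (s j)) ≤ toLex (∑ j, g j a (s j))

/-- The family admits a strategically separable lexicographic representation. -/
def AdmitsLexRepresentation (P : PreferenceFamily S) : Prop :=
  ∃ (M : Type u) (_ : LinearOrder M) (g : ∀ j : Fin n, S 0 → S j.succ → M → ℝ),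
    P.IsLexRepresentation g

/-- The family admits a strategically separable lexicographic representation in which every value
`g j a b` has a well-ordered set of nonzero coordinates, so that any two of the utilities that occur
are comparable. -/
def AdmitsWellOrderedLexRepresentation (P : PreferenceFamily S) : Prop :=
  ∃ (M : Type u) (_ : LinearOrder M) (g : ∀ j : Fin n, S 0 → S j.succ → M → ℝ),
    (∀ j a b, (Function.support (g j a b)).IsWF) ∧ P.IsLexRepresentation g

end PreferenceFamily

/-!
Let `G` be the free abelian group on the triples `(j, a, b)` with `a ∈ S₀` and `b ∈ S_j`. A profile
`x` has an occurrence vector `u(x)` in `G`, the sum over `j` of the basis vectors at `(j, x₀, x_j)`.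
Functions `g j : S₀ × S_j → A` into an abelian group `A` are the same as homomorphisms `G →+ A`, and
the value at the occurrence vector of `x` is `∑ j, g j x₀ x_j`. The counting condition `balanced`
says exactly that the occurrence vectors of the `r k` and those of the `t k` have the same sum
(`sum_profileVector_eq_iff`).

Given a lexicographic representation, a balanced sequence would therefore produce two equal sums in
the ordered group `Lex (M → ℝ)`, one of which dominates the other term by term, strictly in one term.

Conversely, consider the submonoid of `G` generated by the differences `u(r) - u(t)` with
`r₊ = t₊` and `r ≿ t`. The absence of balanced sequences means that it does not contain the negative
of any strict difference. By Zorn's lemma it lies in a submonoid maximal with this property, and a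
maximal one contains `x` or `-x` for each `x`
(`AddSubmonoid.exists_isSpanning_of_forall_neg_notMem`). It is the nonnegative part of a total
preorder on `G` compatible with addition; its quotient by indifference is a linearly ordered abelian
group, and the Hahn embedding theorem places that group inside a lexicographically ordered group of
real Hahn series, whose supports are well-ordered. The coefficients of the images of the basis
vectors are the required functions `g j`.
-/

/-- A submonoid of an abelian group that avoids the negatives of a set `T` of its elements extends
to one that still avoids them and contains `x` or `-x` for every `x`. -/
theorem AddSubmonoid.exists_isSpanning_of_forall_neg_notMem {G : Type*} [AddCommGroup G]
    (C : AddSubmonoid G) (T : Set G) (hTC : T ⊆ C) (hT : ∀ p ∈ T, -p ∉ C) :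
    ∃ D : AddSubmonoid G, C ≤ D ∧ (∀ p ∈ T, -p ∉ D) ∧ D.IsSpanning := by
  obtain ⟨D, hCD, hD⟩ := zorn_le_nonempty₀ {D : AddSubmonoid G | ∀ p ∈ T, -p ∉ D}
    (fun c hc hchain y hy => ⟨sSup c, fun p hp hmem => by
      obtain ⟨E, hE, hpE⟩ :=
        (AddSubmonoid.mem_sSup_of_directedOn ⟨y, hy⟩ hchain.directedOn).1 hmem
      exact hc hE p hp hpE, fun z hz => le_sSup hz⟩) C hT
  refine ⟨D, hCD, hD.prop, ?_⟩
  -- If `x ∉ D`, maximality yields a relation `d + k • x = -p` with `p ∈ T`.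
  have key : ∀ x, x ∉ D → ∃ p ∈ T, ∃ d ∈ D, ∃ k : ℕ, d + k • x = -p := by
    intro x hx
    by_contra! h
    apply hx
    refine hD.le_of_ge (y := D ⊔ AddSubmonoid.closure {x}) ?_ le_sup_left
      (AddSubmonoid.mem_sup_right (AddSubmonoid.subset_closure rfl))
    intro p hp hmem
    obtain ⟨d, hd, z, hz, hdz⟩ := AddSubmonoid.mem_sup.1 hmem
    obtain ⟨k, rfl⟩ := AddSubmonoid.mem_closure_singleton.1 hz
    exact h p hp d hd k hdz
  intro x
  by_contra! h
  obtain ⟨p, hp, d, hd, k, hk⟩ := key x h.1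
  obtain ⟨q, hq, e, he, l, hl⟩ := key (-x) h.2
  -- The coefficient `k` is positive, as `-p ∉ D`.
  obtain _ | k := k
  · refine hD.prop p hp ?_
    rw [← hk]
    simpa using hd
  -- Eliminating `x` between the two relations puts `-q` in `D`.
  refine hD.prop q hq ?_
  have hrel : -q = l • d + (k + 1) • e + (l • p + k • q) := by
    have h1 : l • (d + (k + 1) • x) = l • (-p) := by rw [hk]
    have h2 : (k + 1) • (e + l • (-x)) = (k + 1) • (-q) := by rw [hl]
    have h3 : l • ((k + 1) • x) = (k + 1) • (l • x) := by
      rw [smul_smul, smul_smul, mul_comm]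
    simp only [smul_add, smul_neg, h3] at h1 h2
    rw [succ_nsmul q k] at h2
    have h4 : l • p = -(l • d + (k + 1) • l • x) := by rw [h1, neg_neg]
    have h5 : k • q = -((k + 1) • e + -((k + 1) • l • x)) - q := by rw [h2]; abel
    rw [h4, h5]; abel
  rw [hrel]
  exact add_mem (add_mem (nsmul_mem hd _) (nsmul_mem he _))
    (add_mem (nsmul_mem (hCD (hTC hp)) _) (nsmul_mem (hCD (hTC hq)) _))

/-- A submonoid of an abelian group containing `x` or `-x` for every `x` is the set of elements with
nonnegative image under a homomorphism to a linearly ordered abelian group, the quotient by its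
support. -/
theorem AddSubmonoid.IsSpanning.exists_linearOrder {G : Type u} [AddCommGroup G]
    {D : AddSubmonoid G} (hD : D.IsSpanning) :
    ∃ (Q : Type u) (_ : AddCommGroup Q) (_ : LinearOrder Q) (_ : IsOrderedAddMonoid Q)
      (q : G →+ Q), ∀ x, 0 ≤ q x ↔ x ∈ D := by
  classical
  let q : G →+ G ⧸ D.support := QuotientAddGroup.mk' D.support
  have hq : ∀ x, q x ∈ D.map q ↔ x ∈ D := by
    refine fun x => ⟨?_, AddSubmonoid.mem_map_of_mem q⟩
    rintro ⟨y, hy, hyx⟩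
    have hmem : -y + x ∈ D.support := QuotientAddGroup.eq.1 hyx
    simpa using add_mem hy (AddSubmonoid.mem_support.1 hmem).1
  let K : AddGroupCone (G ⧸ D.support) :=
    { D.map q with
      eq_zero_of_mem_of_neg_mem' := by
        intro a
        obtain ⟨x, rfl⟩ := QuotientAddGroup.mk'_surjective D.support a
        intro h1 h2
        refine (QuotientAddGroup.eq_zero_iff x).2 (AddSubmonoid.mem_support.2 ⟨(hq x).1 h1, ?_⟩)
        exact (hq (-x)).1 (by rw [map_neg]; exact h2) }
  have hK : ∀ x, q x ∈ K ↔ x ∈ D := hq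
  have : HasMemOrNegMem K := ⟨by
    intro a
    obtain ⟨x, rfl⟩ := QuotientAddGroup.mk'_surjective D.support a
    rcases hD x with h | h
    · exact Or.inl ((hK x).2 h)
    · right
      rw [← map_neg]
      exact (hK (-x)).2 h⟩
  refine ⟨G ⧸ D.support, inferInstance, LinearOrder.mkOfAddGroupCone K,
    IsOrderedAddMonoid.mkOfCone K, q, fun x => ?_⟩
  change q x - 0 ∈ K ↔ _
  rw [sub_zero, hK]

namespace PreferenceFamily

variable {n : ℕ} {S : Fin (n + 1) → Type u}

/-- The occurrence vector of a profile `x`: the formal sum over the opponents `j` of the triples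
`(j, x₀, x_j)`. -/
noncomputable def profileVector (x : ∀ i, S i) : (Σ j : Fin n, S 0 × S j.succ) →₀ ℤ :=
  ∑ j : Fin n, Finsupp.single ⟨j, x 0, x j.succ⟩ 1

theorem sum_profileVector_apply {m : ℕ} (r : Fin m → ∀ i, S i) (j : Fin n) (a : S 0)
    (b : S j.succ) :
    (∑ k, profileVector (r k)) ⟨j, a, b⟩ = {k | r k 0 = a ∧ r k j.succ = b}.ncard := by
  classical
  have h : ∀ x : ∀ i, S i,
      profileVector x ⟨j, a, b⟩ = if x 0 = a ∧ x j.succ = b then 1 else 0 := by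
    intro x
    rw [profileVector, Finsupp.finsetSum_apply, Finset.sum_eq_single j]
    · simp [Finsupp.single_apply]
    · intro i _ hi
      rw [Finsupp.single_apply, if_neg]
      exact fun h => hi (congrArg Sigma.fst h)
    · simp
  rw [Finsupp.finsetSum_apply]
  simp only [h]
  rw [Finset.sum_boole, Set.ncard_eq_toFinset_card']
  simp

/-- Two finite sequences of profiles have the same total occurrence vector iff every pair of actions
of player `0` and an opponent occurs equally often in both. -/
theorem sum_profileVector_eq_iff {m : ℕ} (r t : Fin m → ∀ i, S i) :
    ∑ k, profileVector (r k) = ∑ k, profileVector (t k) ↔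
      ∀ (j : Fin n) (a : S 0) (b : S j.succ),
        {k | r k 0 = a ∧ r k j.succ = b}.ncard = {k | t k 0 = a ∧ t k j.succ = b}.ncard := by
  rw [Finsupp.ext_iff]
  refine ⟨fun h j a b => ?_, fun h ⟨j, a, b⟩ => ?_⟩
  · have := h ⟨j, a, b⟩
    rw [sum_profileVector_apply, sum_profileVector_apply] at this
    exact_mod_cast this
  · rw [sum_profileVector_apply, sum_profileVector_apply, h]

theorem AdmitsLexRepresentation.not_admitsBalancedSequence {P : PreferenceFamily S}
    (h : P.AdmitsLexRepresentation) : ¬ P.AdmitsBalancedSequence := by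
  rintro ⟨m, r, t, hrt⟩
  obtain ⟨M, _, g, hg⟩ := h
  let φ : ((Σ j : Fin n, S 0 × S j.succ) →₀ ℤ) →+ Lex (M → ℝ) :=
    Finsupp.liftAddHom fun x => zmultiplesHom _ (toLex (g x.1 x.2.1 x.2.2))
  have hφ : ∀ x, φ (profileVector x) = toLex (∑ j, g j (x 0) (Fin.tail x j)) := by
    intro x
    rw [profileVector, map_sum]
    simp only [φ, Finsupp.liftAddHom_apply_single, zmultiplesHom_apply, one_zsmul]
    rfl
  have hle : ∀ k, φ (profileVector (t k)) ≤ φ (profileVector (r k)) := by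
    intro k
    rw [hφ, hφ, ← hrt.opponents_eq k]
    exact (hg _ _ _).1 (hrt.weak k)
  obtain ⟨k₀, hk₀⟩ := hrt.exists_strict
  have hlt : φ (profileVector (t k₀)) < φ (profileVector (r k₀)) := by
    refine lt_of_le_not_ge (hle k₀) fun hge => hk₀.2 ((hg _ _ _).2 ?_)
    rwa [hφ, hφ, ← hrt.opponents_eq k₀] at hge
  have hsum := Finset.sum_lt_sum (s := Finset.univ) (fun k _ => hle k) ⟨k₀, Finset.mem_univ _, hlt⟩
  rw [← map_sum, ← map_sum, (sum_profileVector_eq_iff r t).2 hrt.balanced] at hsum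
  exact lt_irrefl _ hsum

/-- The pairs `(r, t)` of profiles with the same opponent part `r₊ = t₊` and `r₀ ≿ t₀` there. -/
def WeakPair (P : PreferenceFamily S) : Type u :=
  {p : (∀ i, S i) × (∀ i, S i) //
    Fin.tail p.1 = Fin.tail p.2 ∧ P.weak (Fin.tail p.1) (p.1 0) (p.2 0)}

namespace WeakPair

variable {P : PreferenceFamily S}

/-- The difference of the occurrence vectors of the two profiles of a pair. -/
noncomputable def vector (p : P.WeakPair) : (Σ j : Fin n, S 0 × S j.succ) →₀ ℤ :=
  profileVector p.1.1 - profileVector p.1.2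

/-- The pair `(r, t)` is strict if `r₀ ≻ t₀` at the common opponent part. -/
def IsStrict (p : P.WeakPair) : Prop :=
  P.strict (Fin.tail p.1.1) (p.1.1 0) (p.1.2 0)

/-- Without balanced sequences, the negative of a strict difference is not a sum of weak ones: the
strict pair and the pairs of such a sum would form a balanced sequence. -/
theorem neg_vector_notMem_closure (h : ¬ P.AdmitsBalancedSequence) {p : P.WeakPair}
    (hp : p.IsStrict) : -p.vector ∉ AddSubmonoid.closure (Set.range (vector (P := P))) := by
  intro hmem
  obtain ⟨l, hl, hsum⟩ := AddSubmonoid.exists_list_of_mem_closure hmem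
  obtain ⟨l, rfl⟩ : ∃ l' : List P.WeakPair, l'.map vector = l :=
    Set.mem_range.1 (by rw [Set.range_list_map]; exact hl)
  refine h ⟨(p :: l).length, fun k => ((p :: l).get k).1.1, fun k => ((p :: l).get k).1.2,
    fun k => ((p :: l).get k).2.1, fun k => ((p :: l).get k).2.2, ⟨⟨0, by simp⟩, hp⟩, ?_⟩
  rw [← sum_profileVector_eq_iff, ← sub_eq_zero, ← Finset.sum_sub_distrib]
  have hlist : ((p :: l).map vector).sum = 0 := by
    rw [List.map_cons, List.sum_cons, hsum, add_neg_cancel]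
  rw [← hlist, ← List.sum_ofFn]
  congr 1
  conv_rhs => rw [← List.ofFn_get (p :: l), List.map_ofFn]
  rfl

end WeakPair

theorem admitsWellOrderedLexRepresentation_of_not_admitsBalancedSequence {P : PreferenceFamily S}
    (h : ¬ P.AdmitsBalancedSequence) : P.AdmitsWellOrderedLexRepresentation := by
  obtain ⟨D, hCD, hTD, hD⟩ := AddSubmonoid.exists_isSpanning_of_forall_neg_notMem
    (AddSubmonoid.closure (Set.range (WeakPair.vector (P := P))))
    (WeakPair.vector '' {p | p.IsStrict})
    ((Set.image_subset_range _ _).trans AddSubmonoid.subset_closure)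
    (by rintro _ ⟨p, hp, rfl⟩; exact WeakPair.neg_vector_notMem_closure h hp)
  obtain ⟨Q, _, _, _, q, hq⟩ := hD.exists_linearOrder
  obtain ⟨f, hf, -⟩ := hahnEmbedding_isOrderedAddMonoid Q
  have hf_mono : StrictMono f := f.monotone'.strictMono_of_injective hf
  -- The weak preference is the pullback of the order of `Q`.
  have hweak : ∀ (s : OpponentProfile S) (a b : S 0), P.weak s a b ↔
      q (profileVector (Fin.cons b s : ∀ i, S i)) ≤
        q (profileVector (Fin.cons a s : ∀ i, S i)) := by
    intro s a b
    rw [← sub_nonneg, ← map_sub, hq]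
    have hvec : ∀ a b, P.weak s a b →
        ∃ p : P.WeakPair, p.1.1 = Fin.cons a s ∧ p.1.2 = Fin.cons b s := fun a b hab =>
      ⟨⟨(Fin.cons a s, Fin.cons b s), by simp [hab]⟩, rfl, rfl⟩
    constructor
    · intro hab
      obtain ⟨p, h1, h2⟩ := hvec a b hab
      rw [← h1, ← h2]
      exact hCD (AddSubmonoid.subset_closure ⟨p, rfl⟩)
    · intro hmem
      by_contra hab
      have hba : P.weak s b a := (P.complete s a b).resolve_left hab
      obtain ⟨p, h1, h2⟩ := hvec b a hba
      refine hTD p.vector ⟨p, ?_, rfl⟩ ?_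
      · simpa [WeakPair.IsStrict, h1, h2] using ⟨hba, hab⟩
      · rwa [WeakPair.vector, neg_sub, h1, h2]
  let g : ∀ j : Fin n, S 0 → S j.succ → FiniteArchimedeanClass Q → ℝ := fun j a b =>
    (ofLex (f (q (Finsupp.single ⟨j, a, b⟩ 1)))).coeff
  have hg : ∀ (s : OpponentProfile S) (a : S 0), ∑ j, g j a (s j) =
      (ofLex (f (q (profileVector (Fin.cons a s : ∀ i, S i))))).coeff := by
    intro s a
    let coeffHom : Lex (HahnSeries (FiniteArchimedeanClass Q) ℝ) →+
        (FiniteArchimedeanClass Q → ℝ) :=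
      { toFun := fun x => (ofLex x).coeff
        map_zero' := rfl
        map_add' := fun x y => HahnSeries.coeff_add' (ofLex x) (ofLex y) }
    change ∑ j, g j a (s j) = coeffHom (f (q _))
    rw [profileVector, map_sum, map_sum, map_sum]
    rfl
  refine ⟨FiniteArchimedeanClass Q, inferInstance, g, fun j a b => ?_, fun s a b => ?_⟩
  · exact (ofLex (f (q (Finsupp.single ⟨j, a, b⟩ 1)))).isWF_support
  · rw [hweak, hg, hg, ← hf_mono.le_iff_le]
    rfl

end PreferenceFamily

theorem mainTheorem5 {n : ℕ} {S : Fin (n + 1) → Type u} (P : PreferenceFamily S) :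
    (P.AdmitsLexRepresentation ↔ ¬ P.AdmitsBalancedSequence) ∧
      (P.AdmitsWellOrderedLexRepresentation ↔ ¬ P.AdmitsBalancedSequence) := by
  have hforget : P.AdmitsWellOrderedLexRepresentation → P.AdmitsLexRepresentation :=
    fun ⟨M, hM, g, _, hg⟩ => ⟨M, hM, g, hg⟩
  exact ⟨⟨fun h => h.not_admitsBalancedSequence, fun h => hforget
      (PreferenceFamily.admitsWellOrderedLexRepresentation_of_not_admitsBalancedSequence h)⟩,
    ⟨fun h => (hforget h).not_admitsBalancedSequence,
      PreferenceFamily.admitsWellOrderedLexRepresentation_of_not_admitsBalancedSequence⟩⟩
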